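/- Let $M=(M,\in^M)$ be a model of $\mathsf{ZFA}$, that is, of $\mathsf{ZFC}$ with the Axiom of Foundation replaced by the Anti-Foundation Axiom (every flat system of equations has a unique solution). A \emph{graph} is a set with a symmetric binary relation, which need not be irreflexive. Let $M_1$ be the double-membership graph (D-graph) of $M$: its vertices are the elements of $M$, and $x,y\in M$ (possibly equal) are adjacent if and only if $M\models x\in y$ and $M\models y\in x$. A \emph{graph in the sense of $M$} is a graph whose vertex set is $\{x\in M: M\models x\in d\}$ for some $d\in M$ and whose edge relation is $\{(x,y): M\models (x,y)\in r\}$ for some $r\in M$ which $M$ believes to be a set of Kuratowski pairs of elements of $d$. Connected components (with the induced edge relation) and isomorphisms are understood in the metatheory; in particular, paths have (standard) finite length and isomorphisms need not belong to $M$. Then, up to isomorphism, the connected components of $M_1$ are exactly the connected components of graphs in the sense of $M$: every connected component of $M_1$ is isomorphic to a connected component of some graph in the sense of $M$, and every connected component of a graph in the sense of $M$ is isomorphic to a connected component of $M_1$. Moreover, for every connected component $C$ of $M_1$, infinitely many connected components of $M_1$ are isomorphic to $C$. -/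

import Mathlib

/-- A graph: a vertex type with one symmetric binary relation, which need not be irreflexive. -/
structure LoopyGraph (V : Type*) where
  Adj : V → V → Prop
  symm : ∀ x y, Adj x y → Adj y x

namespace LoopyGraph

/-- The induced graph on a set of vertices. -/
def induce {V : Type*} (G : LoopyGraph V) (C : Set V) : LoopyGraph C where
  Adj x y := G.Adj x y
  symm x y h := G.symm x y h

/-- Isomorphism of graphs. -/
def IsIso {V W : Type*} (G : LoopyGraph V) (H : LoopyGraph W) : Prop :=
  ∃ e : V ≃ W, ∀ x y, G.Adj x y ↔ H.Adj (e x) (e y)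

/-- The connected component of `v`: all vertices that are joined to `v` by a finite path. -/
def component {V : Type*} (G : LoopyGraph V) (v : V) : Set V :=
  {w | Relation.ReflTransGen G.Adj v w}

/-- `C` is (the vertex set of) a connected component of `G`. -/
def IsComponent {V : Type*} (G : LoopyGraph V) (C : Set V) : Prop :=
  ∃ v, C = G.component v

end LoopyGraph

namespace ZFA

/-- The relation symbols of the language of set theory: one binary symbol. -/
inductive SetRel : ℕ → Type
  | mem : SetRel 2

/-- The language `{∈}` of set theory. -/
def setLang : FirstOrder.Language := ⟨fun _ => Empty, SetRel⟩

/-- `Mem x a` is `M ⊨ x ∈ a`. -/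
def Mem {M : Type*} [setLang.Structure M] (x a : M) : Prop :=
  FirstOrder.Language.Structure.RelMap (L := setLang) SetRel.mem ![x, a]

infix:50 " ∈ₘ " => Mem

/-- `M ⊨ c = {a, b}`. -/
def IsUPair {M : Type*} [setLang.Structure M] (c a b : M) : Prop :=
  ∀ z, z ∈ₘ c ↔ z = a ∨ z = b

/-- `M ⊨ p = (a, b)`, where `(a, b) = {{a}, {a, b}}` is the Kuratowski pair. -/
def IsOPair {M : Type*} [setLang.Structure M] (p a b : M) : Prop :=
  ∃ s t, IsUPair s a a ∧ IsUPair t a b ∧ IsUPair p s t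

/-- `M ⊨ (a, b) ∈ r`. -/
def Rel {M : Type*} [setLang.Structure M] (r a b : M) : Prop :=
  ∃ p, IsOPair p a b ∧ p ∈ₘ r

/-- `M ⊨ f is a function with domain X`. -/
def IsFunOn {M : Type*} [setLang.Structure M] (f X : M) : Prop :=
  (∀ p, p ∈ₘ f → ∃ x y, x ∈ₘ X ∧ IsOPair p x y) ∧ ∀ x, x ∈ₘ X → ∃! y, Rel f x y

/-- `M ⊨ S is a flat system of equations x = S_x (x ∈ X) with indeterminates X and set of
sets A`: the sets `X` and `A` are disjoint, `S` is a function on `X`, and each of its values is a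
subset of `X ∪ A`. -/
def IsFlatSystem {M : Type*} [setLang.Structure M] (X A S : M) : Prop :=
  (∀ z, ¬ (z ∈ₘ X ∧ z ∈ₘ A)) ∧ IsFunOn S X ∧
    ∀ x s, Rel S x s → ∀ z, z ∈ₘ s → z ∈ₘ X ∨ z ∈ₘ A

/-- `M ⊨ f is a solution of the flat system (X, A, S)`, that is, `f` is a function on `X` and
`f(x) = {f(y) : y ∈ S_x ∩ X} ∪ (S_x ∩ A)` for all `x ∈ X`. -/
def IsSolution {M : Type*} [setLang.Structure M] (X A S f : M) : Prop :=
  IsFunOn f X ∧ ∀ x s b, Rel S x s → Rel f x b →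
    ∀ z, z ∈ₘ b ↔ (∃ y, y ∈ₘ s ∧ y ∈ₘ X ∧ Rel f y z) ∨ (z ∈ₘ s ∧ z ∈ₘ A)

/-- `M ⊨ ZFA`: the axioms of ZFC other than Foundation, and the Anti-Foundation Axiom, are true
in `M`. In the two schemes `φ` runs over all first-order formulas of the language `{∈}`, and `p`
over all finite tuples of parameters. -/
structure IsModel (M : Type*) [setLang.Structure M] : Prop where
  extensionality : ∀ a b : M, (∀ z, z ∈ₘ a ↔ z ∈ₘ b) → a = b
  empty : ∃ a : M, ∀ z, ¬ z ∈ₘ a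
  pairing : ∀ a b : M, ∃ c, IsUPair c a b
  union : ∀ a : M, ∃ u, ∀ z, z ∈ₘ u ↔ ∃ y, y ∈ₘ a ∧ z ∈ₘ y
  powerset : ∀ a : M, ∃ q, ∀ y, y ∈ₘ q ↔ ∀ z, z ∈ₘ y → z ∈ₘ a
  infinity : ∃ w : M, (∃ e, e ∈ₘ w ∧ ∀ z, ¬ z ∈ₘ e) ∧
    ∀ x, x ∈ₘ w → ∃ s, s ∈ₘ w ∧ ∀ z, z ∈ₘ s ↔ z ∈ₘ x ∨ z = x
  separation : ∀ (n : ℕ) (φ : setLang.Formula (Fin n ⊕ Fin 1)) (p : Fin n → M) (a : M),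
    ∃ b, ∀ x, x ∈ₘ b ↔ x ∈ₘ a ∧ φ.Realize (Sum.elim p ![x])
  replacement : ∀ (n : ℕ) (φ : setLang.Formula (Fin n ⊕ Fin 2)) (p : Fin n → M) (a : M),
    (∀ x, x ∈ₘ a → ∃! y, φ.Realize (Sum.elim p ![x, y])) →
      ∃ b, ∀ y, y ∈ₘ b ↔ ∃ x, x ∈ₘ a ∧ φ.Realize (Sum.elim p ![x, y])
  choice : ∀ a : M, (∀ x, x ∈ₘ a → ∃ z, z ∈ₘ x) →
    (∀ x y, x ∈ₘ a → y ∈ₘ a → (∃ z, z ∈ₘ x ∧ z ∈ₘ y) → x = y) →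
      ∃ c, ∀ x, x ∈ₘ a → ∃! z, z ∈ₘ x ∧ z ∈ₘ c
  antiFoundation : ∀ X A S : M, IsFlatSystem X A S → ∃! f, IsSolution X A S f

/-- The D-graph (double-membership graph) `M₁` of `M`. -/
def dGraph (M : Type*) [setLang.Structure M] : LoopyGraph M where
  Adj x y := x ∈ₘ y ∧ y ∈ₘ x
  symm _ _ h := ⟨h.2, h.1⟩

/-- A graph in the sense of `M`: its domain is an `M`-set, and its edge relation is an `M`-set of
Kuratowski pairs of elements of the domain, and symmetric. -/
structure InternalGraph (M : Type*) [setLang.Structure M] where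
  dom : M
  edge : M
  edge_subset : ∀ p, p ∈ₘ edge → ∃ x y, x ∈ₘ dom ∧ y ∈ₘ dom ∧ IsOPair p x y
  symm : ∀ x y, Rel edge x y → Rel edge y x

/-- The actual graph given by a graph in the sense of `M`: its vertices are the elements `x` of
`M` with `M ⊨ x ∈ dom`. -/
def InternalGraph.toGraph {M : Type*} [setLang.Structure M] (G : InternalGraph M) :
    LoopyGraph {x : M // x ∈ₘ G.dom} where
  Adj x y := Rel G.edge x.1 y.1
  symm x y h := G.symm x.1 y.1 h

end ZFA

/-! If `T` is transitive in `M` and `v ∈ T`, then a D-neighbour of `x ∈ T` is an element of `x`,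
hence lies in `T`. Double membership on `T` is therefore an internal graph having the component of
`v` as a component (`component_isIso_internal`).

Conversely, Anti-Foundation solves `F x = {F y : y ~ x} ∪ {{x, t}}` over the vertices of an internal
graph. For a suitable `t`, the tag `{x, t}` is an element of `F x` that determines `x` and does not
contain `F x`. So `F` is injective and the D-neighbours of `F x` are exactly the `F y` with `y ~ x`
(`exists_realisation`). Only the existence of a solution matters, since the tags give injectivity.

The tags also keep the image of `F` outside any transitive set `B` fixed in advance. Putting a point
of each of finitely many components into `B` yields a further isomorphic copy, whence infinitely
many. -/

/-! ### Graph isomorphisms and components -/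

namespace LoopyGraph

variable {V W U : Type*}

theorem IsIso.symm {G : LoopyGraph V} {H : LoopyGraph W} (h : G.IsIso H) : H.IsIso G := by
  obtain ⟨e, he⟩ := h
  exact ⟨e.symm, fun x y => by simp [he]⟩

theorem IsIso.trans {G : LoopyGraph V} {H : LoopyGraph W} {K : LoopyGraph U}
    (h : G.IsIso H) (h' : H.IsIso K) : G.IsIso K := by
  obtain ⟨e, he⟩ := h
  obtain ⟨e', he'⟩ := h'
  exact ⟨e.trans e', fun x y => by simp [he, he']⟩

/-- A map that sends neighbourhoods onto neighbourhoods sends components onto components. -/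
theorem component_eq_image {G : LoopyGraph V} {H : LoopyGraph W} {F : V → W}
    (hadj : ∀ x w, H.Adj (F x) w ↔ ∃ y, w = F y ∧ G.Adj x y) (v : V) :
    H.component (F v) = F '' G.component v := by
  ext w
  constructor
  · intro h
    induction h with
    | refl => exact ⟨v, Relation.ReflTransGen.refl, rfl⟩
    | tail _ hbc ih =>
      obtain ⟨x, hx, rfl⟩ := ih
      obtain ⟨y, rfl, hxy⟩ := (hadj x _).1 hbc
      exact ⟨y, Relation.ReflTransGen.tail hx hxy, rfl⟩
  · rintro ⟨x, hx, rfl⟩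
    exact Relation.ReflTransGen.lift (r := G.Adj) (p := H.Adj) F
      (fun a b hab => (hadj a _).2 ⟨b, rfl, hab⟩) _ _ hx

theorem isIso_component {G : LoopyGraph V} {H : LoopyGraph W} {F : V → W}
    (hF : Function.Injective F) (hadj : ∀ x w, H.Adj (F x) w ↔ ∃ y, w = F y ∧ G.Adj x y) (v : V) :
    (H.induce (H.component (F v))).IsIso (G.induce (G.component v)) := by
  rw [component_eq_image hadj]
  refine IsIso.symm ⟨Equiv.Set.image F _ hF, fun x y => ?_⟩
  change G.Adj x y ↔ H.Adj (F x) (F y)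
  rw [hadj]
  exact ⟨fun h => ⟨y, rfl, h⟩, fun ⟨z, hz, h⟩ => by rwa [hF hz]⟩

end LoopyGraph

/-! ### First-order definability with parameters -/

namespace ZFA

open FirstOrder Language

theorem elim_append_left {M : Type*} {n m k : ℕ} (p : Fin m → M) (q : Fin k → M) (v : Fin n → M) :
    Sum.elim (Fin.append p q) v ∘ Sum.map (Fin.castAdd k) id = Sum.elim p v := by
  ext (i | i) <;> simp

theorem elim_append_right {M : Type*} {n m k : ℕ} (p : Fin m → M) (q : Fin k → M) (v : Fin n → M) :
    Sum.elim (Fin.append p q) v ∘ Sum.map (Fin.natAdd m) id = Sum.elim q v := by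
  ext (i | i) <;> simp

section Definability

variable {M : Type*} [setLang.Structure M] {n : ℕ}

/-- `t` is given by a term with parameters. -/
class DfnTerm (t : (Fin n → M) → M) : Prop where
  out : ∃ (m : ℕ) (τ : setLang.Term (Fin m ⊕ Fin n)) (p : Fin m → M),
    ∀ v, τ.realize (Sum.elim p v) = t v

/-- `P` is first-order definable with parameters. -/
class Dfn (P : (Fin n → M) → Prop) : Prop where
  out : ∃ (m : ℕ) (φ : setLang.Formula (Fin m ⊕ Fin n)) (p : Fin m → M),
    ∀ v, φ.Realize (Sum.elim p v) ↔ P v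

theorem Dfn.congr {P Q : (Fin n → M) → Prop} (hP : Dfn P) (h : ∀ v, P v ↔ Q v) : Dfn Q :=
  (funext fun v => propext (h v) : P = Q) ▸ hP

instance DfnTerm.var (i : Fin n) : DfnTerm (fun v : Fin n → M => v i) :=
  ⟨0, .var (.inr i), Fin.elim0, fun _ => rfl⟩

instance DfnTerm.const (c : M) : DfnTerm (fun _ : Fin n → M => c) :=
  ⟨1, .var (.inl 0), fun _ => c, fun _ => rfl⟩

instance Dfn.mem {s t : (Fin n → M) → M} [hs : DfnTerm s] [ht : DfnTerm t] :
    Dfn (fun v => s v ∈ₘ t v) := by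
  obtain ⟨m, σ, p, hσ⟩ := hs
  obtain ⟨k, τ, q, hτ⟩ := ht
  refine ⟨m + k, Relations.formula (show setLang.Relations 2 from SetRel.mem)
    ![σ.relabel (Sum.map (Fin.castAdd k) id), τ.relabel (Sum.map (Fin.natAdd m) id)],
    Fin.append p q, fun v => ?_⟩
  rw [Formula.realize_rel, Mem]
  refine iff_of_eq (congrArg _ ?_)
  funext i
  fin_cases i
  · simp [Term.realize_relabel, elim_append_left, hσ]
  · simp [Term.realize_relabel, elim_append_right, hτ]

instance Dfn.eq {s t : (Fin n → M) → M} [hs : DfnTerm s] [ht : DfnTerm t] :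
    Dfn (fun v => s v = t v) := by
  obtain ⟨m, σ, p, hσ⟩ := hs
  obtain ⟨k, τ, q, hτ⟩ := ht
  refine ⟨m + k, Term.equal (σ.relabel (Sum.map (Fin.castAdd k) id))
    (τ.relabel (Sum.map (Fin.natAdd m) id)), Fin.append p q, fun v => ?_⟩
  simp [Formula.realize_equal, Term.realize_relabel, elim_append_left, elim_append_right, hσ, hτ]

instance Dfn.and {P Q : (Fin n → M) → Prop} [hP : Dfn P] [hQ : Dfn Q] :
    Dfn (fun v => P v ∧ Q v) := by
  obtain ⟨m, σ, p, hσ⟩ := hP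
  obtain ⟨k, τ, q, hτ⟩ := hQ
  refine ⟨m + k, (σ.relabel (Sum.map (Fin.castAdd k) id)) ⊓
    (τ.relabel (Sum.map (Fin.natAdd m) id)), Fin.append p q, fun v => ?_⟩
  rw [Formula.realize_inf, Formula.realize_relabel, Formula.realize_relabel, elim_append_left,
    elim_append_right, hσ, hτ]

instance Dfn.not {P : (Fin n → M) → Prop} [hP : Dfn P] : Dfn (fun v => ¬ P v) := by
  obtain ⟨m, σ, p, hσ⟩ := hP
  exact ⟨m, σ.not, p, fun v => by rw [Formula.realize_not, hσ]⟩

/-- The bound variable takes index `0` and the old ones are shifted, so that instance search can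
descend under quantifiers. -/
instance Dfn.ex {P : (Fin n → M) → M → Prop}
    [hP : Dfn (fun w : Fin (n + 1) → M => P (fun i => w i.succ) (w 0))] :
    Dfn (fun v => ∃ x, P v x) := by
  obtain ⟨m, σ, p, hσ⟩ := hP
  refine ⟨m, Formula.iExs (Fin 1) (σ.relabel (Sum.elim (fun i => .inl (.inl i))
    (Fin.cases (.inr 0) fun i => .inl (.inr i)))), p, fun v => ?_⟩
  rw [Formula.realize_iExs]
  have key : ∀ x : Fin 1 → M, Sum.elim (Sum.elim p v) x ∘ (Sum.elim (fun i => .inl (.inl i))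
      (Fin.cases (.inr 0) fun i => .inl (.inr i))) = Sum.elim p (Fin.cons (x 0) v) := by
    intro x
    ext (i | i)
    · rfl
    · refine Fin.cases rfl (fun i => rfl) i
  simp only [Formula.realize_relabel, key, hσ, Fin.cons_succ, Fin.cons_zero]
  exact ⟨fun ⟨x, hx⟩ => ⟨x 0, hx⟩, fun ⟨x, hx⟩ => ⟨fun _ => x, hx⟩⟩

instance Dfn.or {P Q : (Fin n → M) → Prop} [Dfn P] [Dfn Q] : Dfn (fun v => P v ∨ Q v) :=
  Dfn.congr (P := fun v => ¬ (¬ P v ∧ ¬ Q v)) inferInstance fun v => by tauto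

instance Dfn.imp {P Q : (Fin n → M) → Prop} [Dfn P] [Dfn Q] : Dfn (fun v => P v → Q v) :=
  Dfn.congr (P := fun v => ¬ (P v ∧ ¬ Q v)) inferInstance fun v => by tauto

instance Dfn.iff {P Q : (Fin n → M) → Prop} [Dfn P] [Dfn Q] : Dfn (fun v => P v ↔ Q v) :=
  Dfn.congr (P := fun v => (P v → Q v) ∧ (Q v → P v)) inferInstance fun v => by tauto

instance Dfn.all {P : (Fin n → M) → M → Prop}
    [Dfn (fun w : Fin (n + 1) → M => P (fun i => w i.succ) (w 0))] :
    Dfn (fun v => ∀ x, P v x) :=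
  Dfn.congr (P := fun v => ¬ ∃ x, ¬ P v x) inferInstance fun v => by simp

/-- Descending under a quantifier leaves terms precomposed with `Fin.succ`; this instance recognises
them. -/
instance DfnTerm.comp {k : ℕ} {t : (Fin n → M) → M} [h : DfnTerm t] (g : Fin n → Fin k) :
    DfnTerm (fun w : Fin k → M => t (fun i => w (g i))) := by
  obtain ⟨m, τ, p, hτ⟩ := h
  refine ⟨m, τ.relabel (Sum.map id g), p, fun w => ?_⟩
  rw [← hτ, Term.realize_relabel]
  congr 1
  ext (i | i) <;> rfl

instance Dfn.isUPair {a b c : (Fin n → M) → M} [DfnTerm a] [DfnTerm b] [DfnTerm c] :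
    Dfn (fun v => IsUPair (a v) (b v) (c v)) := by
  unfold IsUPair; infer_instance

instance Dfn.isOPair {a b c : (Fin n → M) → M} [DfnTerm a] [DfnTerm b] [DfnTerm c] :
    Dfn (fun v => IsOPair (a v) (b v) (c v)) := by
  unfold IsOPair; infer_instance

instance Dfn.rel {a b c : (Fin n → M) → M} [DfnTerm a] [DfnTerm b] [DfnTerm c] :
    Dfn (fun v => Rel (a v) (b v) (c v)) := by
  unfold Rel; infer_instance

end Definability

end ZFA

/-! ### Set theory inside `M`: pairs, ω and transitive sets -/

namespace ZFA

section SetTheory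

variable {M : Type*} [setLang.Structure M]

/-- `M ⊨ e = ∅`. -/
def IsEmptySet (e : M) : Prop := ∀ z, ¬ z ∈ₘ e

/-- `M ⊨ s = x ∪ {x}`. -/
def IsSucc (s x : M) : Prop := ∀ z, z ∈ₘ s ↔ z ∈ₘ x ∨ z = x

/-- `M ⊨ u = ⋃ a`. -/
def IsUnion (u a : M) : Prop := ∀ z, z ∈ₘ u ↔ ∃ y, y ∈ₘ a ∧ z ∈ₘ y

/-- In `M`, the set `w` contains `∅` and is closed under successors. -/
def IsInductive (w : M) : Prop :=
  (∃ e, e ∈ₘ w ∧ IsEmptySet e) ∧ ∀ x, x ∈ₘ w → ∃ s, s ∈ₘ w ∧ IsSucc s x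

/-- `M ⊨ t is transitive`. -/
def IsTransitive (t : M) : Prop := ∀ x, x ∈ₘ t → ∀ z, z ∈ₘ x → z ∈ₘ t

/-- `f` is an initial part of the recursion along `w` with start `{a}` and step `⋃`. -/
def IsAttempt (w a f : M) : Prop :=
  ∀ p, p ∈ₘ f → ∃ k s, IsOPair p k s ∧ ((IsEmptySet k ∧ IsUPair s a a) ∨
    ∃ l t, l ∈ₘ w ∧ IsSucc k l ∧ Rel f l t ∧ IsUnion s t)

/-- `s` is the `k`-th value of the recursion along `w` with start `{a}` and step `⋃`. -/
def IsIterUnion (w a k s : M) : Prop := ∃ f, IsAttempt w a f ∧ Rel f k s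

variable {n : ℕ}

instance Dfn.isEmptySet {a : (Fin n → M) → M} [DfnTerm a] : Dfn (fun v => IsEmptySet (a v)) := by
  unfold IsEmptySet; infer_instance

instance Dfn.isSucc {a b : (Fin n → M) → M} [DfnTerm a] [DfnTerm b] :
    Dfn (fun v => IsSucc (a v) (b v)) := by
  unfold IsSucc; infer_instance

instance Dfn.isUnion {a b : (Fin n → M) → M} [DfnTerm a] [DfnTerm b] :
    Dfn (fun v => IsUnion (a v) (b v)) := by
  unfold IsUnion; infer_instance

instance Dfn.isInductive {a : (Fin n → M) → M} [DfnTerm a] :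
    Dfn (fun v => IsInductive (a v)) := by
  unfold IsInductive; infer_instance

instance Dfn.isTransitive {a : (Fin n → M) → M} [DfnTerm a] :
    Dfn (fun v => IsTransitive (a v)) := by
  unfold IsTransitive; infer_instance

instance Dfn.isAttempt {a b c : (Fin n → M) → M} [DfnTerm a] [DfnTerm b] [DfnTerm c] :
    Dfn (fun v => IsAttempt (a v) (b v) (c v)) := by
  unfold IsAttempt; infer_instance

instance Dfn.isIterUnion {a b c d : (Fin n → M) → M} [DfnTerm a] [DfnTerm b] [DfnTerm c]
    [DfnTerm d] : Dfn (fun v => IsIterUnion (a v) (b v) (c v) (d v)) := by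
  unfold IsIterUnion; infer_instance

theorem IsUPair.inj_right {p q a b t : M} (hp : IsUPair p a t) (hq : IsUPair q b t) (h : p = q) :
    a = b := by
  subst h
  rcases (hq a).1 ((hp a).2 (Or.inl rfl)) with h | h
  · exact h
  · rcases (hp b).1 ((hq b).2 (Or.inl rfl)) with h' | h' <;> simp_all

theorem IsUPair.inj_left {p a b c : M} (h : IsUPair p a b) (h' : IsUPair p a c) : b = c := by
  have h1 := (h' b).1 ((h b).2 (Or.inr rfl))
  have h2 := (h c).1 ((h' c).2 (Or.inr rfl))
  grind

theorem IsOPair.inj {p a b c d : M} (h : IsOPair p a b) (h' : IsOPair p c d) :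
    a = c ∧ b = d := by
  obtain ⟨s, t, hs, ht, hp⟩ := h
  obtain ⟨s', t', hs', ht', hp'⟩ := h'
  have hac : a = c := by
    rcases (hp s').1 ((hp' s').2 (Or.inl rfl)) with h | h
    · subst h
      simpa using (hs' a).1 ((hs a).2 (Or.inl rfl))
    · subst h
      simpa using (hs' a).1 ((ht a).2 (Or.inl rfl))
  subst hac
  have ht1 := (hp t').1 ((hp' t').2 (Or.inr rfl))
  have ht2 := (hp' t).1 ((hp t).2 (Or.inr rfl))
  refine ⟨rfl, ?_⟩
  rcases ht1 with h | h
  · rcases ht2 with h2 | h2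
    · subst h; subst h2
      exact (ht.inj_left hs').trans (hs.inj_left ht')
    · exact ht.inj_left (h2 ▸ ht')
  · exact ht.inj_left (h ▸ ht')

namespace IsModel

variable (hM : IsModel M)
include hM

theorem ext {a b : M} (h : ∀ z, z ∈ₘ a ↔ z ∈ₘ b) : a = b := hM.extensionality a b h

theorem exists_sep (P : M → Prop) [hP : Dfn (fun v : Fin 1 → M => P (v 0))] (a : M) :
    ∃ b, ∀ x, x ∈ₘ b ↔ x ∈ₘ a ∧ P x := by
  obtain ⟨m, φ, p, hφ⟩ := hP
  simpa [hφ] using hM.separation m φ p a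

theorem exists_image (R : M → M → Prop) [hR : Dfn (fun v : Fin 2 → M => R (v 0) (v 1))] (a : M)
    (h : ∀ x, x ∈ₘ a → ∃! y, R x y) : ∃ b, ∀ y, y ∈ₘ b ↔ ∃ x, x ∈ₘ a ∧ R x y := by
  obtain ⟨m, φ, p, hφ⟩ := hR
  have := hM.replacement m φ p a
  simp only [hφ, Matrix.cons_val_zero, Matrix.cons_val_one] at this
  exact this h

theorem exists_cup (a b : M) : ∃ c, ∀ z, z ∈ₘ c ↔ z ∈ₘ a ∨ z ∈ₘ b := by
  obtain ⟨p, hp⟩ := hM.pairing a b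
  obtain ⟨u, hu⟩ := hM.union p
  refine ⟨u, fun z => ?_⟩
  rw [hu]
  simp [hp _]

theorem upair_unique {p q a b : M} (h : IsUPair p a b) (h' : IsUPair q a b) : p = q :=
  hM.ext fun z => (h z).trans (h' z).symm

theorem exists_oPair (a b : M) : ∃ p, IsOPair p a b := by
  obtain ⟨s, hs⟩ := hM.pairing a a
  obtain ⟨t, ht⟩ := hM.pairing a b
  obtain ⟨p, hp⟩ := hM.pairing s t
  exact ⟨p, s, t, hs, ht, hp⟩

theorem oPair_unique {p q a b : M} (h : IsOPair p a b) (h' : IsOPair q a b) : p = q := by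
  obtain ⟨s, t, hs, ht, hp⟩ := h
  obtain ⟨s', t', hs', ht', hq⟩ := h'
  rw [hM.upair_unique hs' hs, hM.upair_unique ht' ht] at hq
  exact hM.upair_unique hp hq

theorem exists_succ (a : M) : ∃ s, IsSucc s a := by
  obtain ⟨s, hs⟩ := hM.pairing a a
  obtain ⟨c, hc⟩ := hM.exists_cup a s
  exact ⟨c, fun z => by rw [hc, hs, or_self]⟩

/-- Take the intersection of all inductive sets. Its `M`-elements may be nonstandard, so induction
is available only for definable `P`, where separation makes `{x ∈ w : P x}` an inductive set. -/
theorem exists_omega : ∃ w : M, IsInductive w ∧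
    ∀ P : M → Prop, Dfn (fun v : Fin 1 → M => P (v 0)) → (∀ e, IsEmptySet e → P e) →
      (∀ x s, x ∈ₘ w → P x → IsSucc s x → P s) → ∀ x, x ∈ₘ w → P x := by
  obtain ⟨w₀, ⟨e, he, he'⟩, hs₀⟩ := hM.infinity
  obtain ⟨w, hw⟩ := hM.exists_sep (fun x => ∀ y, IsInductive y → x ∈ₘ y) w₀
  have hind : IsInductive w := by
    constructor
    · refine ⟨e, (hw e).2 ⟨he, fun y hy => ?_⟩, he'⟩
      obtain ⟨e₁, h₁, h₁'⟩ := hy.1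
      rwa [hM.ext (a := e) (b := e₁) fun z => ⟨fun h => (he' z h).elim, fun h => (h₁' z h).elim⟩]
    · intro x hx
      obtain ⟨hx₀, hx'⟩ := (hw x).1 hx
      obtain ⟨s, hs, hsx⟩ := hs₀ x hx₀
      refine ⟨s, (hw s).2 ⟨hs, fun y hy => ?_⟩, hsx⟩
      obtain ⟨s₁, h₁, h₁'⟩ := hy.2 x (hx' y hy)
      rwa [hM.ext (a := s) (b := s₁) fun z => (hsx z).trans (h₁' z).symm]
  refine ⟨w, hind, fun P hP h0 hS x hx => ?_⟩
  obtain ⟨u, hu⟩ := hM.exists_sep P w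
  refine ((hu x).1 (((hw x).1 hx).2 u ⟨?_, fun y hy => ?_⟩)).2
  · obtain ⟨e, he, he'⟩ := hind.1
    exact ⟨e, (hu e).2 ⟨he, h0 e he'⟩, he'⟩
  · obtain ⟨hy₁, hy₂⟩ := (hu y).1 hy
    obtain ⟨s, hs, hs'⟩ := hind.2 y hy₁
    exact ⟨s, (hu s).2 ⟨hs, hS y s hy₁ hy₂ hs'⟩, hs'⟩

theorem isIterUnion_empty {w a k s : M} (hk : IsEmptySet k) :
    IsIterUnion w a k s ↔ IsUPair s a a := by
  constructor
  · rintro ⟨f, hf, p, hp, hpf⟩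
    obtain ⟨k', s', hp', h⟩ := hf p hpf
    obtain ⟨rfl, rfl⟩ := hp.inj hp'
    rcases h with h | ⟨l, t, _, hl, _⟩
    · exact h.2
    · exact (hk l ((hl l).2 (Or.inr rfl))).elim
  · intro h
    obtain ⟨p, hp⟩ := hM.exists_oPair k s
    obtain ⟨f, hf⟩ := hM.pairing p p
    refine ⟨f, fun q hq => ⟨k, s, ?_, Or.inl ⟨hk, h⟩⟩, p, hp, (hf p).2 (Or.inl rfl)⟩
    have : q = p := by simpa using (hf q).1 hq
    rwa [this]

/-- An attempt reaching `l` is extended by the single pair `(k, s)`. Uniqueness of the predecessor,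
`hinj`, is what lets an attempt at `k` be read back at `l`. -/
theorem isIterUnion_succ {w a k l s : M} (hl : l ∈ₘ w) (hk : IsSucc k l)
    (hinj : ∀ l', l' ∈ₘ w → IsSucc k l' → l' = l) :
    IsIterUnion w a k s ↔ ∃ t, IsIterUnion w a l t ∧ IsUnion s t := by
  constructor
  · rintro ⟨f, hf, p, hp, hpf⟩
    obtain ⟨k', s', hp', h⟩ := hf p hpf
    obtain ⟨rfl, rfl⟩ := hp.inj hp'
    rcases h with h | ⟨l', t, hl', hkl', hr, hu⟩
    · exact (h.1 l ((hk l).2 (Or.inr rfl))).elim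
    · obtain rfl := hinj l' hl' hkl'
      exact ⟨t, ⟨f, hf, hr⟩, hu⟩
  · rintro ⟨t, ⟨f, hf, q, hq, hqf⟩, hu⟩
    obtain ⟨p, hp⟩ := hM.exists_oPair k s
    obtain ⟨u, hu'⟩ := hM.pairing p p
    obtain ⟨g, hg⟩ := hM.exists_cup f u
    have hfg : ∀ x y, Rel f x y → Rel g x y := fun x y ⟨z, hz, hzf⟩ =>
      ⟨z, hz, (hg z).2 (Or.inl hzf)⟩
    refine ⟨g, fun z hz => ?_, p, hp, (hg p).2 (Or.inr ((hu' p).2 (Or.inl rfl)))⟩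
    rcases (hg z).1 hz with hz | hz
    · obtain ⟨k₁, s₁, h₁, h⟩ := hf z hz
      refine ⟨k₁, s₁, h₁, h.imp_right ?_⟩
      rintro ⟨l₁, t₁, h₂, h₃, h₄, h₅⟩
      exact ⟨l₁, t₁, h₂, h₃, hfg _ _ h₄, h₅⟩
    · have : z = p := by simpa using (hu' z).1 hz
      subst this
      exact ⟨k, s, hp, Or.inr ⟨l, t, hl, hk, hfg _ _ ⟨q, hq, hqf⟩, hu⟩⟩

/-- The union of `{a}, a, ⋃ a, …`, iterated along the ω of `M`, is transitive: an element of an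
element of one stage lies in the next stage. -/
theorem exists_transitive (a : M) : ∃ T : M, a ∈ₘ T ∧ IsTransitive T := by
  obtain ⟨w, hw, hind⟩ := hM.exists_omega
  -- Without Foundation, injectivity of the successor on `w` needs this induction, which rules out
  -- `l ∈ l' ∈ l`.
  have htr : ∀ x, x ∈ₘ w → IsTransitive x ∧ ¬ x ∈ₘ x := by
    refine hind (fun x => IsTransitive x ∧ ¬ x ∈ₘ x) inferInstance ?_ ?_
    · exact fun e he => ⟨fun x hx => (he x hx).elim, he e⟩
    · rintro x s - ⟨hx, hxx⟩ hs
      constructor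
      · intro y hy z hz
        rcases (hs y).1 hy with h | rfl
        · exact (hs z).2 (Or.inl (hx y h z hz))
        · exact (hs z).2 (Or.inl hz)
      · intro hss
        have hxs : x ∈ₘ s := (hs x).2 (Or.inr rfl)
        rcases (hs s).1 hss with h | rfl
        · exact hxx (hx s h x hxs)
        · exact hxx hxs
  have hinj : ∀ k l, l ∈ₘ w → IsSucc k l → ∀ l', l' ∈ₘ w → IsSucc k l' → l' = l := by
    intro k l hl hk l' hl' hk'
    by_contra hne
    have h₁ : l ∈ₘ l' := ((hk' l).1 ((hk l).2 (Or.inr rfl))).resolve_right (Ne.symm hne)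
    have h₂ : l' ∈ₘ l := ((hk l').1 ((hk' l').2 (Or.inr rfl))).resolve_right hne
    exact (htr l hl).2 ((htr l hl).1 l' h₂ l h₁)
  have huniq : ∀ x, x ∈ₘ w → ∃ s, IsIterUnion w a x s ∧ ∀ s', IsIterUnion w a x s' → s' = s := by
    refine hind (fun x => ∃ s, IsIterUnion w a x s ∧ ∀ s', IsIterUnion w a x s' → s' = s)
      inferInstance ?_ ?_
    · intro e he
      obtain ⟨s, hs⟩ := hM.pairing a a
      refine ⟨s, (hM.isIterUnion_empty he).2 hs, fun s' hs' => ?_⟩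
      exact hM.upair_unique ((hM.isIterUnion_empty he).1 hs') hs
    · rintro x k hx ⟨s, hs, hs'⟩ hk
      have key := fun t => hM.isIterUnion_succ (a := a) (s := t) hx hk (hinj k x hx hk)
      obtain ⟨u, hu⟩ := hM.union s
      refine ⟨u, (key u).2 ⟨s, hs, hu⟩, fun u' hu' => ?_⟩
      obtain ⟨t, ht, htu⟩ := (key u').1 hu'
      obtain rfl := hs' t ht
      exact hM.ext fun z => (htu z).trans (hu z).symm
  obtain ⟨b, hb⟩ := hM.exists_image (fun x s => IsIterUnion w a x s) w huniq
  obtain ⟨T, hT⟩ := hM.union b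
  refine ⟨T, ?_, fun x hx z hz => ?_⟩
  · obtain ⟨e, he, he'⟩ := hw.1
    obtain ⟨s, hs⟩ := hM.pairing a a
    exact (hT a).2 ⟨s, (hb s).2 ⟨e, he, (hM.isIterUnion_empty he').2 hs⟩, (hs a).2 (Or.inl rfl)⟩
  · obtain ⟨s, hs, hxs⟩ := (hT x).1 hx
    obtain ⟨l, hl, hls⟩ := (hb s).1 hs
    obtain ⟨k, hk, hkl⟩ := hw.2 l hl
    obtain ⟨u, hu⟩ := hM.union s
    exact (hT z).2 ⟨u, (hb u).2 ⟨k, hk, (hM.isIterUnion_succ hl hkl (hinj k l hl hkl)).2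
      ⟨s, hls, hu⟩⟩, (hu z).2 ⟨x, hxs, hz⟩⟩

end IsModel

end SetTheory

end ZFA

/-! ### Components of the D-graph and of internal graphs -/

namespace ZFA

namespace IsModel

variable {M : Type*} [setLang.Structure M] (hM : IsModel M)
include hM

theorem component_isIso_internal (v : M) :
    ∃ (G : InternalGraph M) (C' : Set {x : M // x ∈ₘ G.dom}), G.toGraph.IsComponent C' ∧
      ((dGraph M).induce ((dGraph M).component v)).IsIso (G.toGraph.induce C') := by
  obtain ⟨T, hv, hT⟩ := hM.exists_transitive v
  -- an ordered pair of elements of `T` belongs to the second power set `R` of `T`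
  obtain ⟨Q, hQ⟩ := hM.powerset T
  obtain ⟨R, hR⟩ := hM.powerset Q
  obtain ⟨r, hr⟩ := hM.exists_sep (fun p => ∃ x y, IsOPair p x y ∧ x ∈ₘ T ∧ y ∈ₘ T ∧
    x ∈ₘ y ∧ y ∈ₘ x) R
  have hrel : ∀ x y, Rel r x y ↔ x ∈ₘ T ∧ y ∈ₘ T ∧ x ∈ₘ y ∧ y ∈ₘ x := by
    intro x y
    constructor
    · rintro ⟨p, hp, hpr⟩
      obtain ⟨-, x', y', hp', h⟩ := (hr p).1 hpr
      obtain ⟨rfl, rfl⟩ := hp.inj hp'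
      exact h
    · intro h
      obtain ⟨p, hp⟩ := hM.exists_oPair x y
      refine ⟨p, hp, (hr p).2 ⟨(hR p).2 fun s hs => (hQ s).2 fun z hz => ?_, x, y, hp, h⟩⟩
      obtain ⟨s₁, s₂, h₁, h₂, h₃⟩ := hp
      rcases (h₃ s).1 hs with rfl | rfl
      · rcases (h₁ z).1 hz with rfl | rfl <;> exact h.1
      · rcases (h₂ z).1 hz with rfl | rfl
        exacts [h.1, h.2.1]
  let G : InternalGraph M :=
    { dom := T
      edge := r
      edge_subset := fun p hp => by
        obtain ⟨-, x, y, hp, hx, hy, -⟩ := (hr p).1 hp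
        exact ⟨x, y, hx, hy, hp⟩
      symm := fun x y h => by
        rw [hrel] at h ⊢
        tauto }
  refine ⟨G, G.toGraph.component ⟨v, hv⟩, ⟨_, rfl⟩, ?_⟩
  refine LoopyGraph.isIso_component (F := Subtype.val) Subtype.val_injective (fun x w => ?_) ⟨v, hv⟩
  constructor
  · intro h
    have hw : w ∈ₘ T := hT x.1 x.2 w h.2
    exact ⟨⟨w, hw⟩, rfl, (hrel _ _).2 ⟨x.2, hw, h⟩⟩
  · rintro ⟨y, rfl, h⟩
    exact ((hrel _ _).1 h).2.2

/-- The flat system `x = {y : y ~ x} ∪ {{x, t}}` attached to a graph has a solution, provided that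
no tag `{x, t}` is a vertex. -/
theorem exists_tagged_solution (G : InternalGraph M) (t : M)
    (ht : ∀ x a, x ∈ₘ G.dom → IsUPair a x t → ¬ a ∈ₘ G.dom) :
    ∃ F : {x : M // x ∈ₘ G.dom} → M, ∀ x z, z ∈ₘ F x ↔
      (∃ y, G.toGraph.Adj x y ∧ z = F y) ∨ IsUPair z x.1 t := by
  have hs : ∀ x, ∃ s, ∀ z, z ∈ₘ s ↔ (z ∈ₘ G.dom ∧ Rel G.edge x z) ∨ IsUPair z x t := by
    intro x
    obtain ⟨n, hn⟩ := hM.exists_sep (fun z => Rel G.edge x z) G.dom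
    obtain ⟨a, ha⟩ := hM.pairing x t
    obtain ⟨b, hb⟩ := hM.pairing a a
    obtain ⟨s, hs⟩ := hM.exists_cup n b
    refine ⟨s, fun z => ?_⟩
    rw [hs, hn, hb, or_self]
    exact or_congr_right ⟨fun h => h ▸ ha, fun h => hM.upair_unique h ha⟩
  obtain ⟨A, hA⟩ := hM.exists_image (fun x a => IsUPair a x t) G.dom fun x _ => by
    obtain ⟨a, ha⟩ := hM.pairing x t
    exact ⟨a, ha, fun b hb => hM.upair_unique hb ha⟩
  obtain ⟨S, hS⟩ := hM.exists_image (fun x p => ∃ s, IsOPair p x s ∧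
      ∀ z, z ∈ₘ s ↔ (z ∈ₘ G.dom ∧ Rel G.edge x z) ∨ IsUPair z x t) G.dom fun x _ => by
    obtain ⟨s, hs⟩ := hs x
    obtain ⟨p, hp⟩ := hM.exists_oPair x s
    refine ⟨p, ⟨s, hp, hs⟩, ?_⟩
    rintro q ⟨s', hq, hs'⟩
    obtain rfl := hM.ext fun z => (hs z).trans (hs' z).symm
    exact hM.oPair_unique hq hp
  have hrel : ∀ x s, Rel S x s ↔ x ∈ₘ G.dom ∧
      ∀ z, z ∈ₘ s ↔ (z ∈ₘ G.dom ∧ Rel G.edge x z) ∨ IsUPair z x t := by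
    intro x s
    constructor
    · rintro ⟨p, hp, hpS⟩
      obtain ⟨x', hx', s', hp', h⟩ := (hS p).1 hpS
      obtain ⟨rfl, rfl⟩ := hp.inj hp'
      exact ⟨hx', h⟩
    · rintro ⟨hx, h⟩
      obtain ⟨p, hp⟩ := hM.exists_oPair x s
      exact ⟨p, hp, (hS p).2 ⟨x, hx, s, hp, h⟩⟩
  have hdisj : ∀ z, ¬ (z ∈ₘ G.dom ∧ z ∈ₘ A) := by
    rintro z ⟨hz, hzA⟩
    obtain ⟨x, hx, hzx⟩ := (hA z).1 hzA
    exact ht x z hx hzx hz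
  have hflat : IsFlatSystem G.dom A S := by
    refine ⟨hdisj, ⟨fun p hp => ?_, fun x hx => ?_⟩, fun x s hxs z hz => ?_⟩
    · obtain ⟨x, hx, s, hp, -⟩ := (hS p).1 hp
      exact ⟨x, s, hx, hp⟩
    · obtain ⟨s, hs⟩ := hs x
      exact ⟨s, (hrel x s).2 ⟨hx, hs⟩, fun s' hs' =>
        hM.ext fun z => (((hrel x s').1 hs').2 z).trans (hs z).symm⟩
    · obtain ⟨hx, h⟩ := (hrel x s).1 hxs
      exact ((h z).1 hz).imp And.left fun h => (hA z).2 ⟨x, hx, h⟩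
  obtain ⟨f, ⟨hf, hsol⟩, -⟩ := hM.antiFoundation _ _ _ hflat
  choose F hF hF' using fun x : {x : M // x ∈ₘ G.dom} => hf.2 x.1 x.2
  refine ⟨F, fun x z => ?_⟩
  obtain ⟨s, hs⟩ := hs x.1
  rw [hsol x.1 s (F x) ((hrel _ _).2 ⟨x.2, hs⟩) (hF x) z]
  refine or_congr ?_ ?_
  · constructor
    · rintro ⟨y, hys, hy, hyz⟩
      rcases (hs y).1 hys with h | h
      · exact ⟨⟨y, hy⟩, h.2, hF' ⟨y, hy⟩ z hyz⟩
      · exact (ht x.1 y x.2 h hy).elim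
    · rintro ⟨y, hxy, rfl⟩
      exact ⟨y.1, (hs y.1).2 (Or.inl ⟨y.2, hxy⟩), y.2, hF y⟩
  · constructor
    · rintro ⟨hzs, hzA⟩
      exact ((hs z).1 hzs).resolve_left fun h => hdisj z ⟨h.1, hzA⟩
    · intro h
      exact ⟨(hs z).2 (Or.inr h), (hA z).2 ⟨x.1, x.2, h⟩⟩

/-- Every graph in the sense of `M` is realised by a union of components of the D-graph, outside
any given transitive set that contains its domain. -/
theorem exists_realisation (G : InternalGraph M) {B : M} (hB : IsTransitive B)
    (hGB : G.dom ∈ₘ B) :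
    ∃ F : {x : M // x ∈ₘ G.dom} → M, Function.Injective F ∧
      (∀ x w, (dGraph M).Adj (F x) w ↔ ∃ y, w = F y ∧ G.toGraph.Adj x y) ∧
        ∀ x, ¬ F x ∈ₘ B := by
  -- The Russell subset of `B` lies neither in `B` nor in itself. Hence no set containing `t`, in
  -- particular no tag, belongs to the transitive set `B`.
  obtain ⟨t, ht⟩ := hM.exists_sep (fun z => ¬ z ∈ₘ z) B
  have htt : ¬ t ∈ₘ t := fun h => ((ht t).1 h).2 h
  have htB : ¬ t ∈ₘ B := fun h => htt ((ht t).2 ⟨h, htt⟩)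
  have hdom : ∀ x, x ∈ₘ G.dom → x ∈ₘ B := hB _ hGB
  have htag : ∀ x a, IsUPair a x t → ¬ a ∈ₘ B := fun x a ha haB =>
    htB (hB a haB t ((ha t).2 (Or.inr rfl)))
  obtain ⟨F, hF⟩ := hM.exists_tagged_solution G t fun x a _ ha h => htag x a ha (hdom a h)
  choose a ha using fun x : {x : M // x ∈ₘ G.dom} => hM.pairing x.1 t
  have haF : ∀ x, a x ∈ₘ F x := fun x => (hF x (a x)).2 (Or.inr (ha x))
  have haa : ∀ x y, ¬ a y ∈ₘ a x := by
    intro x y h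
    rcases (ha x _).1 h with h | h
    · exact htag _ _ (ha y) (h ▸ hdom _ x.2)
    · exact htt (by simpa [h] using (ha y t).2 (Or.inr rfl))
  -- Each `F x` contains a tag, whereas a tag contains none; so the only tag in `F x` is that of
  -- `x`.
  have hFa : ∀ x y, F x ≠ a y := fun x y h => haa y x (h ▸ haF x)
  have hinj : Function.Injective F := by
    intro x y h
    have := haF x
    rw [h, hF] at this
    rcases this with ⟨z, -, hz⟩ | h
    · exact (hFa z x hz.symm).elim
    · exact Subtype.ext ((ha x).inj_right h rfl)
  refine ⟨F, hinj, fun x w => ⟨fun ⟨h₁, h₂⟩ => ?_, ?_⟩, fun x h => ?_⟩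
  · rcases (hF x w).1 h₂ with ⟨y, hy, rfl⟩ | h
    · exact ⟨y, rfl, hy⟩
    -- Here `w` is the tag `{x, t}` and contains `F x`. Both `F x = x` and `F x = t` would put the
    -- tag into `B`.
    · rcases (h _).1 h₁ with h' | h'
      · exact (htag _ _ (ha x) (hB x.1 (hdom _ x.2) _ (h' ▸ haF x))).elim
      · have := haF x
        rw [h', ht] at this
        exact (htag _ _ (ha x) this.1).elim
  · rintro ⟨y, rfl, h⟩
    exact ⟨(hF y _).2 (Or.inl ⟨x, G.toGraph.symm _ _ h, rfl⟩), (hF x _).2 (Or.inl ⟨y, h, rfl⟩)⟩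
  · exact htag _ _ (ha x) (hB _ h _ (haF x))

theorem exists_mem_of_finite {s : Set M} (hs : s.Finite) : ∃ b : M, ∀ x ∈ s, x ∈ₘ b := by
  induction s, hs using Set.Finite.induction_on with
  | empty => exact hM.empty.imp fun b _ x hx => hx.elim
  | @insert a s _ _ ih =>
    obtain ⟨b, hb⟩ := ih
    obtain ⟨c, hc⟩ := hM.pairing a a
    obtain ⟨d, hd⟩ := hM.exists_cup b c
    refine ⟨d, fun x hx => (hd x).2 ?_⟩
    rcases hx with rfl | hx
    · exact Or.inr ((hc x).2 (Or.inl rfl))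
    · exact Or.inl (hb x hx)

/-- A component of a graph in the sense of `M` is isomorphic to a component of the D-graph that
avoids a given finite set. -/
theorem exists_component_avoiding (G : InternalGraph M) {C' : Set {x : M // x ∈ₘ G.dom}}
    (hC' : G.toGraph.IsComponent C') {s : Set M} (hs : s.Finite) :
    ∃ C : Set M, (dGraph M).IsComponent C ∧ ((dGraph M).induce C).IsIso (G.toGraph.induce C') ∧
      Disjoint C s := by
  obtain ⟨v, rfl⟩ := hC'
  obtain ⟨b, hb⟩ := hM.exists_mem_of_finite (hs.insert G.dom)
  obtain ⟨B, hbB, hB⟩ := hM.exists_transitive b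
  obtain ⟨F, hinj, hadj, hFB⟩ :=
    hM.exists_realisation G hB (hB b hbB _ (hb _ (Set.mem_insert _ _)))
  refine ⟨_, ⟨F v, rfl⟩, LoopyGraph.isIso_component hinj hadj v, ?_⟩
  rw [LoopyGraph.component_eq_image hadj, Set.disjoint_left]
  rintro _ ⟨x, -, rfl⟩ hx
  exact hFB x (hB b hbB _ (hb _ (Set.mem_insert_of_mem _ hx)))

end IsModel

end ZFA

theorem mainTheorem5 {M : Type*} [ZFA.setLang.Structure M] (hM : ZFA.IsModel M) :
    (∀ C : Set M, (ZFA.dGraph M).IsComponent C →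
      ∃ (G : ZFA.InternalGraph M) (C' : Set {x : M // ZFA.Mem x G.dom}),
        G.toGraph.IsComponent C' ∧ ((ZFA.dGraph M).induce C).IsIso (G.toGraph.induce C')) ∧
    (∀ (G : ZFA.InternalGraph M) (C' : Set {x : M // ZFA.Mem x G.dom}),
      G.toGraph.IsComponent C' →
        ∃ C : Set M, (ZFA.dGraph M).IsComponent C ∧
          ((ZFA.dGraph M).induce C).IsIso (G.toGraph.induce C')) ∧
    (∀ C : Set M, (ZFA.dGraph M).IsComponent C →
      {C₁ : Set M | (ZFA.dGraph M).IsComponent C₁ ∧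
        ((ZFA.dGraph M).induce C).IsIso ((ZFA.dGraph M).induce C₁)}.Infinite) := by
  refine ⟨?_, fun G C' hC' => ?_, ?_⟩
  · rintro _ ⟨v, rfl⟩
    exact hM.component_isIso_internal v
  · obtain ⟨C, hC, hiso, -⟩ := hM.exists_component_avoiding G hC' Set.finite_empty
    exact ⟨C, hC, hiso⟩
  · rintro _ ⟨v, rfl⟩ hfin
    obtain ⟨G, C', hC', hiso⟩ := hM.component_isIso_internal v
    have : Nonempty M := ⟨v⟩
    -- If there were finitely many copies, a new copy avoiding one point of each would itself be on
    -- the list and so contain its own chosen point.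
    choose! rep hrep using fun (C : Set M) (hC : (ZFA.dGraph M).IsComponent C) =>
      show ∃ x, x ∈ C by
        obtain ⟨x, rfl⟩ := hC
        exact ⟨x, Relation.ReflTransGen.refl⟩
    obtain ⟨C, hC, hCC', hdisj⟩ := hM.exists_component_avoiding G hC' (hfin.image rep)
    exact Set.disjoint_left.1 hdisj (hrep C hC) ⟨C, ⟨hC, hiso.trans hCC'.symm⟩, rfl⟩
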